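/- There is an absolute constant $C>0$ such that the following holds for all integers $d,n_\xi,n_\upsilon\ge 1$ and all reals $0<\eta<1$, $\mu>0$. Let $\xi_1,\dots,\xi_{n_\xi}\in\mathbb R^d$ (private data) be i.i.d. from a distribution in $\mathrm{subG}(\Sigma)$, and let $\upsilon_1,\dots,\upsilon_{n_\upsilon}\in\mathbb R^d$ (public data) be i.i.d. from a distribution in $\mathrm{subG}(\Sigma)$. Here $X\sim\mathrm{subG}(\Sigma)$ means that $\mathbb E[XX^T]=\Sigma$ and that, for some finite $K>0$, $\mathbb E\exp(\langle v,X\rangle^2/K^2)\le 2$ for all unit vectors $v$. Put $\hat\Sigma=\frac1{n_\upsilon}\sum_i\upsilon_i\upsilon_i^T$ and $R=\sqrt{d\,(1+\log(2n_\xi/\eta))}$. When $\hat\Sigma$ is invertible, public-moment-guided truncation (PMT) maps a dataset $(x_1,\dots,x_{n_\xi})$ to $(\tilde x_1,\dots,\tilde x_{n_\xi})$, where $y_i=\hat\Sigma^{-1/2}x_i$, $\tilde x_i=R\,y_i/\|y_i\|_2$ if $\|y_i\|_2\ge R$, and $\tilde x_i=y_i$ otherwise. Let $\mathbf G\sim SG_d(\sigma^2)$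 be a symmetric random $d\times d$ matrix whose entries on and above the diagonal are i.i.d. $N(0,\sigma^2)$, with $$\sigma=\frac{2d\,(1+\log(2n_\xi/\eta))}{\mu\, n_\xi}.$$ 1. (Privacy.) For every realization of the public data with $\hat\Sigma$ invertible, the randomized algorithm which sends a private dataset $(x_1,\dots,x_{n_\xi})$ to $$\tilde\Sigma_{DP}=\frac1{n_\xi}\sum_{i=1}^{n_\xi}\tilde x_i\tilde x_i^T+\mathbf G$$ (the noise being drawn independently of the data) is $\mu$-GDP. That is, for any two datasets differing in at most one sample and any $\alpha\in[0,1]$, every randomized test of level $\alpha$ between the two corresponding output laws has power at most $1-\Phi(\Phi^{-1}(1-\alpha)-\mu)$, where $\Phi$ is the standard normal distribution function and $\Phi(\Phi^{-1}(1-\alpha)-\mu)$ is read as $1$ at $\alpha=0$ and as $0$ at $\alpha=1$. 2. (Noise bound.) With probability at least $1-C\eta$, $$\|\mathbf G\|_2\le 2\sqrt2\;\frac{\sqrt{d^3\log(2d/\eta)}\,(1+\log(2n_\xi/\eta))}{\mu\, n_\xi},$$ where $\|\cdot\|_2$ is the operator norm. (The right-hand side equals $\sigma\sqrt{2d\log(2d/\eta)}$.)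 -/

import Mathlib

open MeasureTheory ProbabilityTheory
open scoped MatrixOrder

noncomputable section

namespace PMT

/-- Matrices carry the product (equivalently, Borel) `σ`-algebra of their entries. -/
instance instMeasurableSpaceMatrix {d : ℕ} : MeasurableSpace (Matrix (Fin d) (Fin d) ℝ) :=
  inferInstanceAs (MeasurableSpace (Fin d → Fin d → ℝ))

/-- Two datasets of size `n` are neighboring if they differ in at most one sample. -/
def Neighboring {X : Type*} {n : ℕ} (x x' : Fin n → X) : Prop :=
  ∃ i, ∀ j, j ≠ i → x j = x' j

/-- `f`-differential privacy of a randomized algorithm `M`, given by the law `M x` of its output on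
each dataset `x`: on neighboring datasets, every (randomized) test `φ` of `H₀ : M x` against
`H₁ : M x'` with level `α` has power at most `1 - f α`. -/
def IsFDP {X Y : Type*} [MeasurableSpace Y] {n : ℕ} (f : ℝ → ℝ)
    (M : (Fin n → X) → Measure Y) : Prop :=
  ∀ x x' : Fin n → X, Neighboring x x' →
    ∀ φ : Y → ℝ, Measurable φ → (∀ y, φ y ∈ Set.Icc (0 : ℝ) 1) →
      ∀ α ∈ Set.Icc (0 : ℝ) 1, ∫ y, φ y ∂(M x) ≤ α → ∫ y, φ y ∂(M x') ≤ 1 - f α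

/-- The cumulative distribution function `Φ` of the standard normal distribution. -/
def stdNormalCDF (t : ℝ) : ℝ := cdf (gaussianReal 0 1) t

/-- The quantile function `Φ⁻¹` of the standard normal distribution, used for `0 < p < 1`. -/
def stdNormalQuantile (p : ℝ) : ℝ := sInf {t : ℝ | p ≤ stdNormalCDF t}

/-- The Gaussian trade-off function `α ↦ Φ (Φ⁻¹ (1 - α) - μ)` on `[0, 1]`; at the end points
`Φ⁻¹ 1 = ∞` and `Φ⁻¹ 0 = -∞`, so the values there are `1` and `0`. -/
def gaussianTradeoff (μ α : ℝ) : ℝ :=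
  if α ≤ 0 then 1
  else if 1 ≤ α then 0
  else stdNormalCDF (stdNormalQuantile (1 - α) - μ)

/-- `μ`-Gaussian differential privacy. -/
def IsGDP {X Y : Type*} [MeasurableSpace Y] {n : ℕ} (μ : ℝ)
    (M : (Fin n → X) → Measure Y) : Prop :=
  IsFDP (gaussianTradeoff μ) M

/-- `X ∼ subG(S)`: all one-dimensional marginals of `X` have `ψ₂`-norm bounded by a common finite
constant, and the second-moment matrix of `X` is `S` (the mean is not required to vanish). -/
structure IsSubG {Ω : Type*} [MeasurableSpace Ω] {d : ℕ} (X : Ω → EuclideanSpace ℝ (Fin d))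
    (S : Matrix (Fin d) (Fin d) ℝ) (P : Measure Ω) : Prop where
  measurable : Measurable X
  psi_two : ∃ K : ℝ, 0 < K ∧ ∀ v : EuclideanSpace ℝ (Fin d), ‖v‖ = 1 →
    ∫⁻ ω, ENNReal.ofReal (Real.exp ((inner ℝ v (X ω)) ^ 2 / K ^ 2)) ∂P ≤ 2
  second_moment : ∀ i j, ∫ ω, X ω i * X ω j ∂P = S i j

/-- `X₁, …, Xₙ` are i.i.d. with a common distribution in `subG(S)`. -/
structure IsIIDSubG {Ω : Type*} [MeasurableSpace Ω] {d n : ℕ}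
    (X : Fin n → Ω → EuclideanSpace ℝ (Fin d))
    (S : Matrix (Fin d) (Fin d) ℝ) (P : Measure Ω) : Prop where
  subG : ∀ i, IsSubG (X i) S P
  indep : iIndepFun X P
  ident : ∀ i j, IdentDistrib (X i) (X j) P P

/-- `G ∼ SG_d(σ²)`: a random symmetric matrix whose entries on and above the diagonal are
i.i.d. `N(0, σ²)`. -/
structure IsSymGaussian {Ω : Type*} [MeasurableSpace Ω] {d : ℕ}
    (G : Ω → Matrix (Fin d) (Fin d) ℝ) (σ : ℝ) (P : Measure Ω) : Prop where
  measurable : Measurable G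
  symm : ∀ ω, (G ω).IsSymm
  law : ∀ i j, i ≤ j → P.map (fun ω => G ω i j) = gaussianReal 0 (σ ^ 2).toNNReal
  indep : iIndepFun
    (fun (p : {p : Fin d × Fin d // p.1 ≤ p.2}) (ω : Ω) => G ω p.1.1 p.1.2) P

/-- The sample second-moment matrix `n⁻¹ ∑ᵢ xᵢ xᵢᵀ`. -/
def secondMoment {d n : ℕ} (x : Fin n → EuclideanSpace ℝ (Fin d)) : Matrix (Fin d) (Fin d) ℝ :=
  (n : ℝ)⁻¹ • ∑ i, Matrix.vecMulVec (x i).ofLp (x i).ofLp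

/-- The truncation radius `√(d (1 + log (2n / η)))`. -/
def radius (d n : ℕ) (η : ℝ) : ℝ := √(d * (1 + Real.log (2 * n / η)))

/-- Truncation of a vector to the closed ball of radius `R`. -/
def truncate {d : ℕ} (R : ℝ) (x : EuclideanSpace ℝ (Fin d)) : EuclideanSpace ℝ (Fin d) :=
  if R ≤ ‖x‖ then (R / ‖x‖) • x else x

/-- Public-moment-guided truncation of the private dataset `x` with public second-moment matrix `S`
(positive definite): each sample is multiplied by `S^(-1/2)` and then truncated. -/
def pmt {d n : ℕ} (η : ℝ) (S : Matrix (Fin d) (Fin d) ℝ)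
    (x : Fin n → EuclideanSpace ℝ (Fin d)) : Fin n → EuclideanSpace ℝ (Fin d) :=
  fun i => truncate (radius d n η) (WithLp.toLp 2 ((CFC.sqrt S)⁻¹.mulVec (x i).ofLp))

/-- The law of the released matrix `n⁻¹ ∑ᵢ x̃ᵢ x̃ᵢᵀ + G` on the fixed private dataset `x`, where
`x̃` is the truncated dataset and only the noise `G` is random. -/
def dpSecondMoment {Ω : Type*} [MeasurableSpace Ω] {d n : ℕ} (η : ℝ)
    (S : Matrix (Fin d) (Fin d) ℝ) (G : Ω → Matrix (Fin d) (Fin d) ℝ) (P : Measure Ω)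
    (x : Fin n → EuclideanSpace ℝ (Fin d)) : Measure (Matrix (Fin d) (Fin d) ℝ) :=
  P.map (fun ω => secondMoment (pmt η S x) + G ω)

/-- The noise level `2 d (1 + log (2n / η)) / (μ n)`. -/
def noiseLevel (d n : ℕ) (η μ : ℝ) : ℝ :=
  2 * d * (1 + Real.log (2 * n / η)) / (μ * n)

/-- The operator norm `‖A‖₂` of a matrix acting on Euclidean space. -/
def opNorm {d : ℕ} (A : Matrix (Fin d) (Fin d) ℝ) : ℝ :=
  ‖Matrix.toEuclideanCLM (n := Fin d) (𝕜 := ℝ) A‖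

end PMT

end

open scoped ENNReal NNReal RealInnerProductSpace

/-! Privacy. The released matrix is symmetric, so it is a function of its entries on and above the
diagonal, where the noise is a Gaussian vector with independent coordinates. Truncation caps every
sample at norm `R`, whatever the whitening matrix, so changing one sample moves the mean vector by
at most `√2 R² / n` (`sum_upperEntries_sub_sq_le`), while `μ σ = 2 R² / n`. By Neyman–Pearson the
best test between two such Gaussians at distance `D` is a half-space, of power `1 - Φ (Φ⁻¹ (1 - α) -
D / σ)` (`integral_pi_gaussianReal_le`).

Noise bound. `‖G‖` equals `|⟨G u, u⟩|` for some unit `u`, and each `⟨G x, x⟩` is Gaussian of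
variance at most `(2 - 1/d) σ² ‖x‖⁴`. Instead of a union bound over a net, Fubini is used: when `‖G‖
> s`, the form stays above `c s` on a whole ball of radius `1/100` around `u`, so comparing volumes
of balls costs a factor `101 ^ d` (`measure_le_of_forall_exists_ball_subset`). At `s = σ √(2 d log
(2d/η))` with `d ≥ 2`, the tail is at most a multiple of `(2d)^(-9d/20) η`, and `(2d)^(-9d/20)`
absorbs `101 ^ d` up to an absolute constant. For `d = 1` the matrix is a single Gaussian. -/

/-! ### Densities and linear images of product Gaussians -/

theorem MeasureTheory.Measure.pi_withDensity {ι : Type*} [Fintype ι] {α : ι → Type*}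
    [∀ i, MeasurableSpace (α i)] (μ : ∀ i, Measure (α i)) [∀ i, IsProbabilityMeasure (μ i)]
    (f : ∀ i, α i → ℝ≥0∞) (hf : ∀ i, Measurable (f i))
    [∀ i, SigmaFinite ((μ i).withDensity (f i))] :
    (Measure.pi μ).withDensity (fun x => ∏ i, f i (x i)) =
      Measure.pi fun i => (μ i).withDensity (f i) := by
  classical
  symm
  refine Measure.pi_eq fun s hs => ?_
  rw [withDensity_apply _ (MeasurableSet.univ_pi hs),
    ← lintegral_indicator (MeasurableSet.univ_pi hs)]
  -- The indicator of a box splits over coordinates, so the integral factors by independence.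
  have h1 : (Set.univ.pi s).indicator (fun x => ∏ i, f i (x i)) =
      fun x => ∏ i, (s i).indicator (f i) (x i) := by
    ext x
    by_cases hx : x ∈ Set.univ.pi s
    · rw [Set.indicator_of_mem hx]
      exact Finset.prod_congr rfl fun i _ => (Set.indicator_of_mem (hx i trivial) _).symm
    · rw [Set.indicator_of_notMem hx]
      obtain ⟨i, hi⟩ : ∃ i, x i ∉ s i := by simpa using hx
      exact (Finset.prod_eq_zero (Finset.mem_univ i) (Set.indicator_of_notMem hi _)).symm
  have hm : ∀ i, Measurable ((s i).indicator (f i)) := fun i => (hf i).indicator (hs i)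
  rw [h1, lintegral_prod_eq_prod_lintegral_of_indepFun Finset.univ
    (fun i (x : ∀ i, α i) => (s i).indicator (f i) (x i))
    (iIndepFun_pi fun i => (hm i).aemeasurable) fun i => (hm i).comp (measurable_pi_apply i)]
  refine Finset.prod_congr rfl fun i _ => ?_
  rw [withDensity_apply _ (hs i), ← lintegral_indicator (hs i)]
  exact (measurePreserving_eval μ i).lintegral_comp (hm i)

theorem gaussianReal_eq_withDensity_gaussianReal_zero (m : ℝ) {v : ℝ≥0} (hv : v ≠ 0) :
    gaussianReal m v = (gaussianReal 0 v).withDensity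
      fun x => ENNReal.ofReal (Real.exp ((m * x - m ^ 2 / 2) / v)) := by
  have hv' : (v : ℝ) ≠ 0 := by exact_mod_cast hv
  rw [gaussianReal_of_var_ne_zero m hv, gaussianReal_of_var_ne_zero 0 hv, ← withDensity_mul _
    (measurable_gaussianPDF _ _) (by fun_prop)]
  congr 1
  ext x
  simp only [Pi.mul_apply, gaussianPDF, gaussianPDFReal]
  rw [← ENNReal.ofReal_mul (by positivity), mul_assoc _ (Real.exp _) (Real.exp _),
    ← Real.exp_add]
  congr 3
  field_simp
  ring

theorem pi_gaussianReal_eq_withDensity {ι : Type*} [Fintype ι] (m : ι → ℝ) {v : ℝ≥0}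
    (hv : v ≠ 0) :
    Measure.pi (fun i => gaussianReal (m i) v) =
      (Measure.pi fun _ : ι => gaussianReal 0 v).withDensity
        fun x => ENNReal.ofReal (Real.exp ((∑ i, m i * x i - (∑ i, m i ^ 2) / 2) / v)) := by
  have h := gaussianReal_eq_withDensity_gaussianReal_zero (hv := hv)
  have : ∀ i, SigmaFinite ((gaussianReal 0 v).withDensity
      fun x => ENNReal.ofReal (Real.exp ((m i * x - m i ^ 2 / 2) / v))) := fun i => by
    rw [← h]; infer_instance
  rw [show (fun i => gaussianReal (m i) v) = _ from funext fun i => h (m i),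
    ← Measure.pi_withDensity _ _ fun i => by fun_prop]
  congr 1
  ext x
  rw [← ENNReal.ofReal_prod_of_nonneg fun _ _ => (Real.exp_pos _).le, ← Real.exp_sum,
    ← Finset.sum_div, Finset.sum_sub_distrib, Finset.sum_div]

/-- Serves twice: for the log-likelihood ratio of two shifted Gaussians, and for the quadratic forms
of the noise matrix. -/
theorem map_sum_mul_eq_gaussianReal {Ω ι : Type*} [MeasurableSpace Ω] {P : Measure Ω}
    {X : ι → Ω → ℝ} (hX : ∀ i, Measurable (X i)) (hind : iIndepFun X P) {m : ι → ℝ} {v : ℝ≥0}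
    (hlaw : ∀ i, P.map (X i) = gaussianReal (m i) v) (c : ι → ℝ) (s : Finset ι) :
    P.map (fun ω => ∑ i ∈ s, c i * X i ω) =
      gaussianReal (∑ i ∈ s, c i * m i) ((∑ i ∈ s, c i ^ 2).toNNReal * v) := by
  classical
  have := hind.isProbabilityMeasure
  have hm : ∀ i, Measurable fun ω => c i * X i ω := fun i => (hX i).const_mul _
  have hind' : iIndepFun (fun i ω => c i * X i ω) P :=
    hind.comp (fun i x => c i * x) fun i => by fun_prop
  induction s using Finset.induction_on with
  | empty => simp
  | insert i s his ih =>
    have hi : P.map (fun ω => c i * X i ω) =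
        gaussianReal (c i * m i) ((c i ^ 2).toNNReal * v) := by
      rw [show (fun ω => c i * X i ω) = (fun x => c i * x) ∘ X i from rfl,
        ← Measure.map_map (by fun_prop) (hX i), hlaw,
        gaussianReal_map_const_mul]
      congr 2
      ext; simp [sq_nonneg]
    have hI := (hind'.indepFun_finsetSum_of_notMem hm his).symm
    rw [show (∑ j ∈ s, fun ω => c j * X j ω) = fun ω => ∑ j ∈ s, c j * X j ω by
      ext; simp] at hI
    have := gaussianReal_add_gaussianReal_of_indepFun hI hi ih
    rw [show ((fun ω => c i * X i ω) + fun ω => ∑ j ∈ s, c j * X j ω) =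
      fun ω => ∑ j ∈ insert i s, c j * X j ω by ext; simp [Finset.sum_insert his]] at this
    rw [this, Finset.sum_insert his, Finset.sum_insert his, ← add_mul,
      Real.toNNReal_add (sq_nonneg _) (Finset.sum_nonneg fun _ _ => sq_nonneg _)]

/-! ### Optimal tests and the Gaussian trade-off function -/

/-- The Neyman–Pearson inequality for a simple alternative with density `L`. -/
theorem integral_withDensity_sub_le {Y : Type*} [MeasurableSpace Y] (ν : Measure Y)
    [IsProbabilityMeasure ν] {L : Y → ℝ} (hL : Measurable L) (hL0 : ∀ y, 0 ≤ L y)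
    [IsProbabilityMeasure (ν.withDensity fun y => ENNReal.ofReal (L y))] {f : Y → ℝ}
    (hf : Measurable f) (hf01 : ∀ y, f y ∈ Set.Icc (0 : ℝ) 1) (c : ℝ) :
    ∫ y, f y ∂(ν.withDensity fun y => ENNReal.ofReal (L y)) -
        (ν.withDensity fun y => ENNReal.ofReal (L y)).real {y | c < L y} ≤
      c * (∫ y, f y ∂ν - ν.real {y | c < L y}) := by
  have hA : MeasurableSet {y | c < L y} := measurableSet_lt measurable_const hL
  have hLi : Integrable L ν := by
    refine ⟨hL.aestronglyMeasurable, ?_⟩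
    have h1 : (ν.withDensity fun y => ENNReal.ofReal (L y)) Set.univ = 1 := measure_univ
    rw [withDensity_apply _ MeasurableSet.univ, setLIntegral_univ] at h1
    rw [hasFiniteIntegral_iff_ofReal (ae_of_all _ hL0), h1]
    exact ENNReal.one_lt_top
  have key : ∀ g : Y → ℝ, ∫ y, g y ∂(ν.withDensity fun y => ENNReal.ofReal (L y)) =
      ∫ y, L y * g y ∂ν := fun g => by
    rw [integral_withDensity_eq_integral_toReal_smul (by fun_prop) (by simp)]
    simp [ENNReal.toReal_ofReal (hL0 _)]
  set g : Y → ℝ := Set.indicator {y | c < L y} 1 with hg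
  have hgm : Measurable g := measurable_one.indicator hA
  have hb : ∀ y, ‖f y‖ ≤ 1 := fun y => by
    rw [Real.norm_eq_abs, abs_of_nonneg (hf01 y).1]; exact (hf01 y).2
  have hgb : ∀ y, ‖g y‖ ≤ 1 := fun y => by
    rw [hg, Set.indicator_apply]; split_ifs <;> simp
  have hfi : Integrable f ν := Integrable.of_bound hf.aestronglyMeasurable 1 (ae_of_all _ hb)
  have hgi : Integrable g ν := Integrable.of_bound hgm.aestronglyMeasurable 1 (ae_of_all _ hgb)
  have hLf : Integrable (fun y => L y * f y) ν :=
    hLi.mul_bdd hf.aestronglyMeasurable (ae_of_all _ hb)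
  have hLg : Integrable (fun y => L y * g y) ν :=
    hLi.mul_bdd hgm.aestronglyMeasurable (ae_of_all _ hgb)
  rw [← integral_indicator_one hA, ← integral_indicator_one hA, key, key,
    ← integral_sub hLf hLg, ← integral_sub hfi hgi, ← integral_const_mul]
  -- Pointwise, `(L - c) (f - g) ≤ 0`... with `g` the likelihood-ratio test: `f ≤ 1 = g` where `L >
  -- c`, and `f ≥ 0 = g` elsewhere.
  refine integral_mono (hLf.sub hLg) ((hfi.sub hgi).const_mul c) fun y => ?_
  show L y * f y - L y * g y ≤ c * (f y - g y)
  by_cases hy : c < L y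
  · have : g y = 1 := Set.indicator_of_mem (s := {y | c < L y}) hy _
    nlinarith [(hf01 y).2]
  · have : g y = 0 := Set.indicator_of_notMem (s := {y | c < L y}) hy _
    nlinarith [(hf01 y).1]

namespace PMT

theorem stdNormalCDF_eq (t : ℝ) : stdNormalCDF t = (gaussianReal 0 1).real (Set.Iic t) :=
  cdf_eq_real _ _

theorem monotone_stdNormalCDF : Monotone stdNormalCDF := monotone_cdf _

/-- The jump of a distribution function at a point is the mass of that point, and the Gaussian has
no atoms. -/
theorem continuous_stdNormalCDF : Continuous stdNormalCDF := by
  have := nullSingletonClass_gaussianReal (μ := 0) (v := 1) one_ne_zero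
  refine continuous_iff_continuousAt.2 fun t => ?_
  rw [monotone_stdNormalCDF.continuousAt_iff_leftLim_eq_rightLim]
  have h := (cdf (gaussianReal 0 1)).measure_singleton t
  rw [measure_cdf, measure_singleton, eq_comm, ENNReal.ofReal_eq_zero, sub_nonpos] at h
  exact le_antisymm (monotone_stdNormalCDF.leftLim_le_rightLim le_rfl)
    (((cdf (gaussianReal 0 1)).rightLim_eq t).trans_le h)

theorem stdNormalCDF_stdNormalQuantile {p : ℝ} (h0 : 0 < p) (h1 : p < 1) :
    stdNormalCDF (stdNormalQuantile p) = p := by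
  have hne : {t : ℝ | p ≤ stdNormalCDF t}.Nonempty :=
    (((tendsto_cdf_atTop (gaussianReal 0 1)).eventually_const_le h1)).exists
  have hbdd : BddBelow {t : ℝ | p ≤ stdNormalCDF t} := by
    obtain ⟨b, hb⟩ := ((tendsto_cdf_atBot (gaussianReal 0 1)).eventually_lt_const h0).exists
    refine ⟨b, fun t ht => le_of_not_gt fun htb => ?_⟩
    exact absurd (ht.trans (monotone_stdNormalCDF htb.le)) (not_le.2 hb)
  have hcl : IsClosed {t : ℝ | p ≤ stdNormalCDF t} :=
    isClosed_le continuous_const continuous_stdNormalCDF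
  -- For the remaining inequality, approach the quantile from the left, where the distribution
  -- function is still below `p`.
  refine le_antisymm ?_ (hcl.csInf_mem hne hbdd)
  refine le_of_tendsto (continuous_stdNormalCDF.continuousAt.tendsto.mono_left
    (nhdsWithin_le_nhds (s := Set.Iio (stdNormalQuantile p)))) ?_
  filter_upwards [self_mem_nhdsWithin] with t ht
  exact le_of_not_ge fun h => absurd (csInf_le hbdd h) (not_le.2 ht)

theorem gaussianReal_real_Ioi (m : ℝ) {s : ℝ} (hs : 0 < s) (t : ℝ) :
    (gaussianReal m (s ^ 2).toNNReal).real (Set.Ioi t) = 1 - stdNormalCDF ((t - m) / s) := by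
  have h : gaussianReal m (s ^ 2).toNNReal = (gaussianReal 0 1).map fun x => s * x + m := by
    rw [show (fun x => s * x + m) = (fun x => x + m) ∘ (fun x => s * x) from rfl,
      ← Measure.map_map (by fun_prop) (by fun_prop),
      gaussianReal_map_const_mul, gaussianReal_map_add_const]
    congr 1
    · simp
    · ext; simp [sq_nonneg]
  rw [h, map_measureReal_apply (by fun_prop) measurableSet_Ioi, stdNormalCDF_eq,
    ← probReal_compl_eq_one_sub measurableSet_Iic]
  congr 1
  ext x
  simp only [Set.mem_preimage, Set.mem_Ioi, Set.mem_compl_iff, Set.mem_Iic, not_le]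
  rw [div_lt_iff₀ hs, sub_lt_iff_lt_add, mul_comm]

/-- A test between two product Gaussian laws with common variance `σ ^ 2` whose means are at
distance at most `μ σ` has power bounded by the Gaussian trade-off function. -/
theorem integral_pi_gaussianReal_le {ι : Type*} [Fintype ι] {σ μ : ℝ} (hσ : 0 < σ)
    (hμ : 0 ≤ μ) {Δ : ι → ℝ} (hΔ : ∑ i, Δ i ^ 2 ≤ (μ * σ) ^ 2) {f : (ι → ℝ) → ℝ}
    (hf : Measurable f) (hf01 : ∀ y, f y ∈ Set.Icc (0 : ℝ) 1) {α : ℝ}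
    (hle : ∫ y, f y ∂(Measure.pi fun _ : ι => gaussianReal 0 (σ ^ 2).toNNReal) ≤ α) :
    ∫ y, f y ∂(Measure.pi fun i : ι => gaussianReal (Δ i) (σ ^ 2).toNNReal) ≤
      1 - gaussianTradeoff μ α := by
  have hv : (σ ^ 2).toNNReal ≠ 0 := by simp [hσ.ne']
  have hv' : ((σ ^ 2).toNNReal : ℝ) = σ ^ 2 := Real.coe_toNNReal _ (sq_nonneg _)
  have hwd := pi_gaussianReal_eq_withDensity Δ hv
  rw [hv'] at hwd
  set ν := Measure.pi fun _ : ι => gaussianReal 0 (σ ^ 2).toNNReal with hν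
  set ν' := Measure.pi fun i : ι => gaussianReal (Δ i) (σ ^ 2).toNNReal with hν'
  have hfb : ∀ y, ‖f y‖ ≤ 1 := fun y => by
    rw [Real.norm_eq_abs, abs_of_nonneg (hf01 y).1]; exact (hf01 y).2
  have hfi : Integrable f ν := Integrable.of_bound hf.aestronglyMeasurable 1 (ae_of_all _ hfb)
  have hfi' : Integrable f ν' := Integrable.of_bound hf.aestronglyMeasurable 1 (ae_of_all _ hfb)
  unfold gaussianTradeoff
  split_ifs with h0 h1
  -- A test of level zero vanishes almost everywhere, and the shifted Gaussian is absolutely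
  -- continuous with respect to the centred one.
  · have hz : f =ᵐ[ν] 0 := by
      rw [← integral_eq_zero_iff_of_nonneg (fun y => (hf01 y).1) hfi]
      exact le_antisymm (hle.trans h0) (integral_nonneg fun y => (hf01 y).1)
    have hz' : f =ᵐ[ν'] 0 := by
      rw [hwd]
      exact (withDensity_absolutelyContinuous _ _).ae_eq hz
    rw [integral_congr_ae hz']
    simp
  · calc ∫ y, f y ∂ν' ≤ ∫ _, (1 : ℝ) ∂ν' :=
          integral_mono hfi' (integrable_const _) fun y => (hf01 y).2
      _ = 1 - 0 := by simp
  push Not at h0 h1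
  set t := stdNormalQuantile (1 - α) with ht
  have hΦ : stdNormalCDF t = 1 - α := stdNormalCDF_stdNormalQuantile (by linarith) (by linarith)
  have hsum0 : 0 ≤ ∑ i, Δ i ^ 2 := Finset.sum_nonneg fun _ _ => sq_nonneg _
  -- Equal means are split off: the half-space below is normalised by `D`, which must be positive.
  rcases hsum0.eq_or_lt with hS | hS
  · have hΔ0 : ∀ i, Δ i = 0 := fun i => by
      have := (Finset.sum_eq_zero_iff_of_nonneg fun i _ => sq_nonneg (Δ i)).1 hS.symm i
        (Finset.mem_univ i)
      exact pow_eq_zero_iff two_ne_zero |>.1 this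
    have : ν' = ν := by simp [hν, hν', hΔ0]
    rw [this]
    have := monotone_stdNormalCDF (show t - μ ≤ t by linarith)
    linarith
  set D := √(∑ i, Δ i ^ 2) with hD
  have hD0 : 0 < D := Real.sqrt_pos.2 hS
  have hD2 : D ^ 2 = ∑ i, Δ i ^ 2 := Real.sq_sqrt hsum0
  have hDμ : D ≤ μ * σ := Real.sqrt_le_iff.2 ⟨by positivity, hΔ⟩
  have hL : Measurable fun x : ι → ℝ =>
      Real.exp ((∑ i, Δ i * x i - (∑ i, Δ i ^ 2) / 2) / σ ^ 2) := by fun_prop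
  have hprob : IsProbabilityMeasure (ν.withDensity fun x => ENNReal.ofReal
      (Real.exp ((∑ i, Δ i * x i - (∑ i, Δ i ^ 2) / 2) / σ ^ 2))) := by
    rw [← hwd]; infer_instance
  -- The threshold turns the likelihood-ratio test into the half-space `∑ Δᵢ xᵢ > D σ t`, whose
  -- level under `ν` is exactly `α`.
  have hNP := integral_withDensity_sub_le ν hL (fun _ => (Real.exp_pos _).le) hf hf01
    (Real.exp ((D * σ * t - D ^ 2 / 2) / σ ^ 2))
  rw [← hwd] at hNP
  have hset : {x : ι → ℝ | Real.exp ((D * σ * t - D ^ 2 / 2) / σ ^ 2) <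
      Real.exp ((∑ i, Δ i * x i - (∑ i, Δ i ^ 2) / 2) / σ ^ 2)} =
      (fun x => ∑ i, Δ i * x i) ⁻¹' Set.Ioi (D * σ * t) := by
    ext x
    rw [Set.mem_ofPred_eq, Real.exp_lt_exp, div_lt_div_iff_of_pos_right (by positivity), ← hD2]
    simp
  have hlaw : ∀ m : ι → ℝ, ((Measure.pi fun i : ι => gaussianReal (m i) (σ ^ 2).toNNReal).real
      ((fun x => ∑ i, Δ i * x i) ⁻¹' Set.Ioi (D * σ * t))) =
      1 - stdNormalCDF ((D * σ * t - ∑ i, Δ i * m i) / (D * σ)) := fun m => by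
    rw [← map_measureReal_apply (by fun_prop) measurableSet_Ioi]
    rw [map_sum_mul_eq_gaussianReal (X := fun i (x : ι → ℝ) => x i) (fun i => by fun_prop)
      (iIndepFun_pi (X := fun _ x => x) fun i => by fun_prop) (m := m) (v := (σ ^ 2).toNNReal)
      (fun i => (measurePreserving_eval _ i).map_eq), ← hD2,
      ← Real.toNNReal_mul (sq_nonneg _), ← mul_pow]
    exact gaussianReal_real_Ioi _ (by positivity) _
  have e1 : (D * σ * t - ∑ i, Δ i * (0 : ℝ)) / (D * σ) = t := by
    simp; field_simp
  have e2 : (D * σ * t - ∑ i, Δ i * Δ i) / (D * σ) = t - D / σ := by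
    simp_rw [← pow_two]; rw [← hD2]; field_simp
  have l1 := hlaw fun _ => 0
  have l2 := hlaw Δ
  rw [e1, hΦ] at l1
  rw [e2] at l2
  rw [hset, l1, l2] at hNP
  have h3 : stdNormalCDF (t - μ) ≤ stdNormalCDF (t - D / σ) :=
    monotone_stdNormalCDF (by have := (div_le_iff₀ hσ).2 hDμ; linarith)
  -- The test `f` has level at most that of the half-space, so the Neyman–Pearson right-hand side is
  -- nonpositive.
  have h4 := mul_nonpos_of_nonneg_of_nonpos (Real.exp_pos ((D * σ * t - D ^ 2 / 2) / σ ^ 2)).le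
    (show ∫ y, f y ∂ν - (1 - (1 - α)) ≤ 0 by linarith)
  linarith

/-! ### Symmetric matrices in upper-triangular coordinates -/

/-- The index set of the entries on and above the diagonal. -/
abbrev UpperIndex (d : ℕ) : Type := {p : Fin d × Fin d // p.1 ≤ p.2}

/-- The entries of a matrix on and above the diagonal. -/
def upperEntries {d : ℕ} (A : Matrix (Fin d) (Fin d) ℝ) (p : UpperIndex d) : ℝ := A p.1.1 p.1.2

/-- The symmetric matrix with prescribed entries on and above the diagonal. -/
def ofUpperEntries {d : ℕ} (u : UpperIndex d → ℝ) : Matrix (Fin d) (Fin d) ℝ :=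
  fun i j => if h : i ≤ j then u ⟨(i, j), h⟩ else u ⟨(j, i), le_of_not_ge h⟩

theorem ofUpperEntries_upperEntries {d : ℕ} {A : Matrix (Fin d) (Fin d) ℝ} (hA : A.IsSymm) :
    ofUpperEntries (upperEntries A) = A := by
  ext i j
  unfold ofUpperEntries upperEntries
  split_ifs
  · rfl
  · exact hA.apply i j

theorem measurable_ofUpperEntries {d : ℕ} :
    Measurable (ofUpperEntries : (UpperIndex d → ℝ) → Matrix (Fin d) (Fin d) ℝ) := by
  refine measurable_pi_iff.2 fun i => measurable_pi_iff.2 fun j => ?_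
  unfold ofUpperEntries
  split_ifs
  · exact measurable_pi_apply _
  · exact measurable_pi_apply _

theorem measurable_upperEntries {d : ℕ} :
    Measurable (upperEntries : Matrix (Fin d) (Fin d) ℝ → UpperIndex d → ℝ) :=
  measurable_pi_iff.2 fun p => (measurable_pi_apply p.1.2).comp (measurable_pi_apply p.1.1)

theorem IsSymGaussian.measurable_apply {Ω : Type*} [MeasurableSpace Ω] {P : Measure Ω} {d : ℕ}
    {G : Ω → Matrix (Fin d) (Fin d) ℝ} {σ : ℝ} (hG : IsSymGaussian G σ P) (i j : Fin d) :
    Measurable fun ω => G ω i j :=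
  (measurable_pi_apply (X := fun _ => ℝ) j).comp
    ((measurable_pi_apply (X := fun _ => Fin d → ℝ) i).comp hG.measurable)

theorem IsSymGaussian.map_upperEntries {Ω : Type*} [MeasurableSpace Ω] {P : Measure Ω} {d : ℕ}
    {G : Ω → Matrix (Fin d) (Fin d) ℝ} {σ : ℝ} (hG : IsSymGaussian G σ P) :
    P.map (fun ω => upperEntries (G ω)) =
      Measure.pi fun _ : UpperIndex d => gaussianReal 0 (σ ^ 2).toNNReal := by
  have h := hG.indep.map_fun_eq_pi_map fun p : UpperIndex d => (hG.measurable_apply p.1.1 p.1.2).aemeasurable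
  exact h.trans (congrArg Measure.pi (funext fun p => hG.law _ _ p.2))

theorem map_const_add_pi_gaussianReal {ι : Type*} [Fintype ι] (m : ι → ℝ) (v : NNReal) :
    (Measure.pi fun _ : ι => gaussianReal 0 v).map (fun z => m + z) =
      Measure.pi fun i => gaussianReal (m i) v := by
  have h : ∀ i, (gaussianReal 0 v).map (fun z => m i + z) = gaussianReal (m i) v := fun i => by
    rw [gaussianReal_map_const_add, zero_add]
  have : ∀ i, SigmaFinite ((gaussianReal 0 v).map fun z => m i + z) := fun i => by
    rw [h]; infer_instance
  simp_rw [← h]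
  exact (Measure.pi_map_pi fun i => (measurable_const_add (m i)).aemeasurable)

theorem secondMoment_apply {d n : ℕ} (x : Fin n → EuclideanSpace ℝ (Fin d)) (i j : Fin d) :
    secondMoment x i j = (n : ℝ)⁻¹ * ∑ k, x k i * x k j := by
  simp [secondMoment, Matrix.sum_apply, Matrix.vecMulVec_apply]

theorem isSymm_secondMoment {d n : ℕ} (x : Fin n → EuclideanSpace ℝ (Fin d)) :
    (secondMoment x).IsSymm := by
  refine Matrix.IsSymm.ext fun i j => ?_
  simp_rw [secondMoment_apply, mul_comm]

/-- The entries of symmetric noise are dependent across the diagonal. Passing to the upper entries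
gives a product Gaussian, to which the test bound applies. -/
theorem integral_dpSecondMoment {Ω : Type*} [MeasurableSpace Ω] {P : Measure Ω} {d n : ℕ}
    {G : Ω → Matrix (Fin d) (Fin d) ℝ} {σ : ℝ} (hG : IsSymGaussian G σ P) (η : ℝ)
    (S : Matrix (Fin d) (Fin d) ℝ) (x : Fin n → EuclideanSpace ℝ (Fin d))
    {φ : Matrix (Fin d) (Fin d) ℝ → ℝ} (hφ : Measurable φ) :
    ∫ y, φ y ∂(dpSecondMoment η S G P x) =
      ∫ z, φ (ofUpperEntries (upperEntries (secondMoment (pmt η S x)) + z))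
        ∂(Measure.pi fun _ : UpperIndex d => gaussianReal 0 (σ ^ 2).toNNReal) := by
  have hs : (fun ω => secondMoment (pmt η S x) + G ω) = fun ω =>
      ofUpperEntries (upperEntries (secondMoment (pmt η S x)) + upperEntries (G ω)) := by
    ext1 ω
    exact (ofUpperEntries_upperEntries ((isSymm_secondMoment _).add (hG.symm ω))).symm
  have hu : Measurable fun ω => upperEntries (G ω) := measurable_upperEntries.comp hG.measurable
  have hT : Measurable fun z : UpperIndex d → ℝ =>
      ofUpperEntries (upperEntries (secondMoment (pmt η S x)) + z) :=
    measurable_ofUpperEntries.comp (measurable_const_add _)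
  unfold dpSecondMoment
  rw [hs, ← hG.map_upperEntries]
  exact (integral_map (hT.comp hu).aemeasurable hφ.aestronglyMeasurable).trans
    (integral_map hu.aemeasurable (hφ.comp hT).aestronglyMeasurable).symm

/-! ### Sensitivity and privacy -/

theorem norm_truncate_le {d : ℕ} {R : ℝ} (hR : 0 ≤ R) (x : EuclideanSpace ℝ (Fin d)) :
    ‖truncate R x‖ ≤ R := by
  unfold truncate
  split_ifs with h
  · rw [norm_smul, Real.norm_eq_abs, abs_of_nonneg (by positivity)]
    rcases (norm_nonneg x).eq_or_lt with hx | hx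
    · rwa [← hx, mul_zero]
    · rw [div_mul_cancel₀ _ hx.ne']
  · exact (not_le.1 h).le

/-- The squared Frobenius norm of `b bᵀ - a aᵀ` is `‖b‖⁴ + ‖a‖⁴ - 2 ⟨a, b⟩²`, and the cross term
only helps. -/
theorem sum_sum_mul_sub_mul_sq_le {d : ℕ} {R : ℝ} {a b : EuclideanSpace ℝ (Fin d)}
    (ha : ‖a‖ ≤ R) (hb : ‖b‖ ≤ R) :
    ∑ i, ∑ j, (b i * b j - a i * a j) ^ 2 ≤ 2 * R ^ 4 := by
  have h1 : ∑ i, ∑ j, (b i * b j - a i * a j) ^ 2 =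
      (∑ i, b i ^ 2) ^ 2 + (∑ i, a i ^ 2) ^ 2 - 2 * (∑ i, a i * b i) ^ 2 := by
    simp_rw [pow_two (Finset.sum _ _), Finset.sum_mul_sum, Finset.mul_sum,
      ← Finset.sum_add_distrib, ← Finset.sum_sub_distrib]
    refine Finset.sum_congr rfl fun i _ => Finset.sum_congr rfl fun j _ => ?_
    ring
  have h2 : ∀ c : EuclideanSpace ℝ (Fin d), ‖c‖ ≤ R → (∑ i, c i ^ 2) ^ 2 ≤ R ^ 4 := fun c hc => by
    rw [← EuclideanSpace.real_norm_sq_eq, ← pow_mul]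
    exact pow_le_pow_left₀ (norm_nonneg _) hc 4
  rw [h1]
  linarith [h2 a ha, h2 b hb, sq_nonneg (∑ i, a i * b i)]

theorem sum_upperIndex_eq_sum_filter {d : ℕ} (f : Fin d → Fin d → ℝ) :
    ∑ p : UpperIndex d, f p.1.1 p.1.2 = ∑ p : Fin d × Fin d with p.1 ≤ p.2, f p.1 p.2 :=
  (Finset.sum_subtype _ (by simp) fun p : Fin d × Fin d => f p.1 p.2).symm

theorem sum_upperIndex_le {d : ℕ} {f : Fin d → Fin d → ℝ} (hf : ∀ i j, 0 ≤ f i j) :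
    ∑ p : UpperIndex d, f p.1.1 p.1.2 ≤ ∑ i, ∑ j, f i j := by
  rw [← Fintype.sum_prod_type' f, sum_upperIndex_eq_sum_filter]
  exact Finset.sum_le_sum_of_subset_of_nonneg (Finset.filter_subset _ _) fun p _ _ => hf _ _

/-- The sensitivity of the truncated second-moment matrix. -/
theorem sum_upperEntries_sub_sq_le {d n : ℕ} {R : ℝ} {x x' : Fin n → EuclideanSpace ℝ (Fin d)}
    (h : Neighboring x x') (hx : ∀ i, ‖x i‖ ≤ R) (hx' : ∀ i, ‖x' i‖ ≤ R) :
    ∑ p, (upperEntries (secondMoment x') p - upperEntries (secondMoment x) p) ^ 2 ≤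
      2 * R ^ 4 / n ^ 2 := by
  obtain ⟨k, hk⟩ := h
  have he : ∀ i j, secondMoment x' i j - secondMoment x i j =
      (n : ℝ)⁻¹ * (x' k i * x' k j - x k i * x k j) := fun i j => by
    rw [secondMoment_apply, secondMoment_apply, ← mul_sub, ← Finset.sum_sub_distrib]
    congr 1
    refine Finset.sum_eq_single k (fun l _ hl => ?_) fun h => absurd (Finset.mem_univ k) h
    rw [hk l hl, sub_self]
  refine (sum_upperIndex_le (f := fun i j => (secondMoment x' i j - secondMoment x i j) ^ 2)
    fun i j => sq_nonneg _).trans ?_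
  simp_rw [he, mul_pow, ← Finset.mul_sum]
  rw [inv_pow, inv_mul_eq_div]
  gcongr
  exact sum_sum_mul_sub_mul_sq_le (hx k) (hx' k)

theorem one_lt_two_mul_div {n : ℕ} (hn : 1 ≤ n) {η : ℝ} (h0 : 0 < η) (h1 : η < 1) :
    1 < 2 * (n : ℝ) / η := by
  have : (1 : ℝ) ≤ n := by exact_mod_cast hn
  rw [lt_div_iff₀ h0]
  linarith

theorem noiseLevel_pos {d n : ℕ} (hd : 1 ≤ d) (hn : 1 ≤ n) {η μ : ℝ} (h0 : 0 < η) (h1 : η < 1)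
    (hμ : 0 < μ) : 0 < noiseLevel d n η μ := by
  have := Real.log_pos (one_lt_two_mul_div hn h0 h1)
  have hd' : (0 : ℝ) < d := by exact_mod_cast hd
  have hn' : (0 : ℝ) < n := by exact_mod_cast hn
  unfold noiseLevel
  positivity

/-- The Gaussian mechanism applied to the truncated second-moment matrix is `μ`-GDP. -/
theorem isGDP_dpSecondMoment {Ω : Type*} [MeasurableSpace Ω] {P : Measure Ω} {d n : ℕ}
    (hd : 1 ≤ d) (hn : 1 ≤ n) {η μ : ℝ} (h0 : 0 < η) (h1 : η < 1) (hμ : 0 < μ)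
    (S : Matrix (Fin d) (Fin d) ℝ) {G : Ω → Matrix (Fin d) (Fin d) ℝ}
    (hG : IsSymGaussian G (noiseLevel d n η μ) P) :
    IsGDP μ (fun x : Fin n → EuclideanSpace ℝ (Fin d) => dpSecondMoment η S G P x) := by
  intro x x' hxx' φ hφ hφ01 α _ hle
  have hlog := Real.log_pos (one_lt_two_mul_div hn h0 h1)
  have hn' : (0 : ℝ) < n := by exact_mod_cast hn
  rw [integral_dpSecondMoment hG η S _ hφ] at hle ⊢
  set m := upperEntries (secondMoment (pmt η S x))
  set m' := upperEntries (secondMoment (pmt η S x'))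
  have hT : Measurable fun z : UpperIndex d → ℝ => φ (ofUpperEntries (m + z)) :=
    hφ.comp (measurable_ofUpperEntries.comp (measurable_const_add _))
  -- Both outputs are read as the same test, recentred at `m`, so that one law is centred and the
  -- other has mean `m' - m`.
  have hshift : ∫ z, φ (ofUpperEntries (m' + z))
      ∂(Measure.pi fun _ : UpperIndex d => gaussianReal 0 (noiseLevel d n η μ ^ 2).toNNReal) =
      ∫ z, φ (ofUpperEntries (m + z)) ∂(Measure.pi fun p : UpperIndex d =>
        gaussianReal ((m' - m) p) (noiseLevel d n η μ ^ 2).toNNReal) := by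
    rw [← map_const_add_pi_gaussianReal (m' - m), integral_map (by fun_prop) hT.aestronglyMeasurable]
    simp_rw [← add_assoc, add_sub_cancel]
  rw [hshift]
  refine integral_pi_gaussianReal_le (noiseLevel_pos hd hn h0 h1 hμ) hμ.le ?_ hT
    (fun _ => hφ01 _) hle
  have hR := fun (y : Fin n → EuclideanSpace ℝ (Fin d)) i =>
    norm_truncate_le (Real.sqrt_nonneg (d * (1 + Real.log (2 * n / η))))
      (WithLp.toLp 2 ((CFC.sqrt S)⁻¹.mulVec (y i).ofLp))
  have hnb : Neighboring (pmt η S x) (pmt η S x') := by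
    obtain ⟨k, hk⟩ := hxx'
    exact ⟨k, fun j hj => by unfold pmt; rw [hk j hj]⟩
  refine (sum_upperEntries_sub_sq_le hnb (hR x) (hR x')).trans ?_
  have hR4 : √(d * (1 + Real.log (2 * n / η))) ^ 4 = (d * (1 + Real.log (2 * n / η))) ^ 2 := by
    rw [show (4 : ℕ) = 2 * 2 from rfl, pow_mul, Real.sq_sqrt (by positivity)]
  -- Here `(μ σ)² = 4 R⁴ / n²`, twice the sensitivity bound `2 R⁴ / n²`.
  rw [hR4, noiseLevel, show μ * (2 * d * (1 + Real.log (2 * n / η)) / (μ * n)) =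
    2 * (d * (1 + Real.log (2 * n / η))) / n by field_simp, div_pow]
  gcongr
  rw [mul_pow 2]
  gcongr
  norm_num

end PMT

/-! ### Operator norms, a volumetric union bound and Gaussian tails -/

/-- The norm of a symmetric operator is the supremum of its absolute Rayleigh quotient, attained by
compactness of the sphere. -/
theorem ContinuousLinearMap.IsSymmetric.exists_abs_inner_eq_norm {E : Type*}
    [NormedAddCommGroup E] [InnerProductSpace ℝ E] [FiniteDimensional ℝ E] [Nontrivial E]
    {T : E →L[ℝ] E} (hT : (T : E →ₗ[ℝ] E).IsSymmetric) :
    ∃ u : E, ‖u‖ = 1 ∧ |⟪T u, u⟫| = ‖T‖ := by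
  have hne : (Metric.sphere (0 : E) 1).Nonempty := NormedSpace.sphere_nonempty.2 zero_le_one
  obtain ⟨u, hu, hmax⟩ := (isCompact_sphere (0 : E) 1).exists_isMaxOn hne
    (f := fun x => |⟪T x, x⟫|) (by fun_prop)
  have hu1 : ‖u‖ = 1 := by simpa using hu
  refine ⟨u, hu1, le_antisymm ?_ ?_⟩
  · calc |⟪T u, u⟫| ≤ ‖T u‖ * ‖u‖ := abs_real_inner_le_norm _ _
      _ ≤ ‖T‖ * ‖u‖ * ‖u‖ := by gcongr; exact T.le_opNorm u
      _ = ‖T‖ := by rw [hu1]; ring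
  · rw [T.norm_eq_iSup_rayleighQuotient hT]
    refine ciSup_le fun x => ?_
    rcases eq_or_ne x 0 with rfl | hx
    · simp
    have hx' : ‖x‖ ≠ 0 := norm_ne_zero_iff.2 hx
    have hmem : ‖x‖⁻¹ • x ∈ Metric.sphere (0 : E) 1 := by
      simp [norm_smul, hx']
    have := hmax hmem
    simp only [Set.mem_ofPred_eq, map_smul, inner_smul_left, inner_smul_right] at this
    convert! this using 2
    simp [ContinuousLinearMap.rayleighQuotient, ContinuousLinearMap.reApplyInnerSelf_apply]
    field_simp

/-- Replacing `u` by `x` in one slot at a time loses `ε (1 + ε)` and then `ε`, in units of `‖T‖`. -/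
theorem ContinuousLinearMap.mul_norm_le_abs_inner {E : Type*} [NormedAddCommGroup E]
    [InnerProductSpace ℝ E] (T : E →L[ℝ] E) {u x : E} {ε : ℝ} (hu : ‖u‖ = 1)
    (hTu : |⟪T u, u⟫| = ‖T‖) (hx : ‖x - u‖ ≤ ε) :
    (1 - 2 * ε - ε ^ 2) * ‖T‖ ≤ |⟪T x, x⟫| := by
  have hx1 : ‖x‖ ≤ 1 + ε := by
    have := norm_add_le u (x - u)
    rw [add_sub_cancel] at this
    linarith
  have hε : 0 ≤ ε := (norm_nonneg _).trans hx
  have h1 : |⟪T (x - u), x⟫| ≤ ‖T‖ * ε * (1 + ε) :=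
    calc |⟪T (x - u), x⟫| ≤ ‖T (x - u)‖ * ‖x‖ := abs_real_inner_le_norm _ _
      _ ≤ ‖T‖ * ‖x - u‖ * ‖x‖ := by gcongr; exact T.le_opNorm _
      _ ≤ ‖T‖ * ε * (1 + ε) := by gcongr
  have h2 : |⟪T u, x - u⟫| ≤ ‖T‖ * ε :=
    calc |⟪T u, x - u⟫| ≤ ‖T u‖ * ‖x - u‖ := abs_real_inner_le_norm _ _
      _ ≤ ‖T‖ * ‖u‖ * ‖x - u‖ := by gcongr; exact T.le_opNorm _
      _ ≤ ‖T‖ * ε := by rw [hu, mul_one]; gcongr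
  have h3 : ⟪T u, u⟫ = ⟪T x, x⟫ - ⟪T (x - u), x⟫ - ⟪T u, x - u⟫ := by
    rw [map_sub, inner_sub_left, inner_sub_right]; ring
  have h4 : ‖T‖ ≤ |⟪T x, x⟫| + |⟪T (x - u), x⟫| + |⟪T u, x - u⟫| := by
    rw [← hTu, h3]
    exact (abs_sub _ _).trans (add_le_add_left (abs_sub _ _) _)
  nlinarith

/-- A volumetric union bound: if on the event `B` the section of `W` contains a ball of radius `ε`
inside the ball of radius `r`, then the probability of `B` exceeds that of the sections of `W` over
points at most by the factor `(r / ε) ^ d`. -/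
theorem measure_le_of_forall_exists_ball_subset {Ω E : Type*} [MeasurableSpace Ω] {P : Measure Ω}
    [IsProbabilityMeasure P] [NormedAddCommGroup E] [NormedSpace ℝ E] [FiniteDimensional ℝ E]
    [MeasurableSpace E] [BorelSpace E] {W : Set (Ω × E)} (hW : MeasurableSet W)
    {B : Set Ω} {ε r : ℝ} (hε : 0 < ε) (hr : 0 < r) {δ : ENNReal}
    (hδ : ∀ x ∈ Metric.ball (0 : E) r, P {ω | (ω, x) ∈ W} ≤ δ)
    (hB : ∀ ω ∈ B, ∃ u : E, Metric.ball u ε ⊆ Metric.ball 0 r ∩ {x | (ω, x) ∈ W}) :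
    P B ≤ δ * ENNReal.ofReal ((r / ε) ^ Module.finrank ℝ E) := by
  let ν : Measure E := Measure.addHaar
  let W' : Set (Ω × E) := W ∩ Set.univ ×ˢ Metric.ball (0 : E) r
  have hW' : MeasurableSet W' := hW.inter (MeasurableSet.univ.prod measurableSet_ball)
  have hup : (P.prod ν) W' ≤ δ * ν (Metric.ball 0 r) := by
    rw [Measure.prod_apply_symm hW', ← setLIntegral_const, ← lintegral_indicator
      measurableSet_ball]
    refine lintegral_mono fun x => ?_
    by_cases hx : x ∈ Metric.ball (0 : E) r
    · rw [Set.indicator_of_mem hx]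
      exact (measure_mono fun ω hω => hω.1).trans (hδ x hx)
    · rw [Set.indicator_of_notMem hx, nonpos_iff_eq_zero]
      exact measure_mono_null (fun ω hω => hx hω.2.2) measure_empty
  -- Markov's inequality for the volume of the section over `ω`: on `B` it is at least that of an
  -- `ε`-ball, by translation invariance.
  have hlow : ν (Metric.ball 0 ε) * P B ≤ (P.prod ν) W' := by
    rw [Measure.prod_apply hW']
    refine le_trans ?_ (mul_meas_ge_le_lintegral (measurable_measure_prodMk_left hW')
      (ν (Metric.ball 0 ε)))
    gcongr
    intro ω hω
    obtain ⟨u, hu⟩ := hB ω hω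
    rw [Set.mem_ofPred_eq, ← Measure.addHaar_ball_center ν u ε]
    exact measure_mono fun x hx => ⟨(hu hx).2, trivial, (hu hx).1⟩
  have h := hlow.trans hup
  rw [Measure.addHaar_ball_of_pos ν 0 hε, Measure.addHaar_ball_of_pos ν 0 hr] at h
  have hb0 : ν (Metric.ball 0 1) ≠ 0 := (Metric.measure_ball_pos ν 0 one_pos).ne'
  have hbt : ν (Metric.ball 0 1) ≠ ⊤ := measure_ball_lt_top.ne
  have hε0 : ENNReal.ofReal (ε ^ Module.finrank ℝ E) ≠ 0 := by simp [hε]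
  rw [div_pow, ENNReal.ofReal_div_of_pos (by positivity), ← mul_div_assoc,
    ENNReal.le_div_iff_mul_le (Or.inl hε0) (Or.inl ENNReal.ofReal_ne_top)]
  refine (ENNReal.mul_le_mul_iff_left hb0 hbt).1 ?_
  calc _ = _ := by ring
    _ ≤ _ := h
    _ = _ := by ring

theorem measure_le_abs_le_of_map_eq_gaussianReal {Ω : Type*} [MeasurableSpace Ω] {P : Measure Ω}
    [IsProbabilityMeasure P] {X : Ω → ℝ} (hX : Measurable X) {v : NNReal}
    (hlaw : P.map X = gaussianReal 0 v) {t : ℝ} (ht : 0 ≤ t) :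
    P.real {ω | t ≤ |X ω|} ≤ 2 * Real.exp (-t ^ 2 / (2 * v)) := by
  have hsub : HasSubgaussianMGF X v P := by
    refine ⟨fun s => ?_, fun s => ?_⟩
    · have := integrable_exp_mul_gaussianReal (μ := 0) (v := v) s
      rw [← hlaw] at this
      exact this.comp_measurable hX
    · rw [mgf_gaussianReal hlaw, zero_mul, zero_add]
  have h1 := hsub.measure_ge_le ht
  have h2 := hsub.neg.measure_ge_le ht
  have : {ω | t ≤ |X ω|} = {ω | t ≤ X ω} ∪ {ω | t ≤ (-X) ω} := by
    ext ω; simp [le_abs]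
  rw [this]
  refine (measureReal_union_le _ _).trans ?_
  linarith

namespace PMT

/-! ### Operator norm of the Gaussian noise -/

/-- The quadratic form of a matrix. -/
def quadForm {d : ℕ} (A : Matrix (Fin d) (Fin d) ℝ) (x : EuclideanSpace ℝ (Fin d)) : ℝ :=
  ∑ i, ∑ j, A i j * (x i * x j)

theorem inner_toEuclideanCLM {d : ℕ} (A : Matrix (Fin d) (Fin d) ℝ)
    (x : EuclideanSpace ℝ (Fin d)) :
    ⟪Matrix.toEuclideanCLM (n := Fin d) (𝕜 := ℝ) A x, x⟫ = quadForm A x := by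
  simp only [PiLp.inner_apply, Matrix.ofLp_toEuclideanCLM, Matrix.mulVec, dotProduct, quadForm,
    RCLike.inner_apply, conj_trivial, Finset.mul_sum]
  refine Finset.sum_congr rfl fun i _ => Finset.sum_congr rfl fun j _ => ?_
  ring

theorem sum_sum_eq_sum_upperIndex {d : ℕ} {f : Fin d → Fin d → ℝ} (hf : ∀ i j, f i j = f j i) :
    ∑ i, ∑ j, f i j =
      ∑ p : UpperIndex d, (if p.1.1 = p.1.2 then 1 else 2) * f p.1.1 p.1.2 := by
  rw [← Fintype.sum_prod_type' f, sum_upperIndex_eq_sum_filter fun i j =>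
    (if i = j then 1 else 2) * f i j,
    ← Finset.sum_filter_add_sum_filter_not _ fun p : Fin d × Fin d => p.1 ≤ p.2]
  have h : ∑ p : Fin d × Fin d with ¬ p.1 ≤ p.2, f p.1 p.2 =
      ∑ p : Fin d × Fin d with p.1 ≤ p.2, if p.1 = p.2 then 0 else f p.1 p.2 := by
    simp_rw [← ite_not (_ = _), ← Finset.sum_filter, Finset.filter_filter]
    refine Finset.sum_equiv (Equiv.prodComm _ _) (fun p => ?_) fun p _ => hf _ _
    simp [lt_iff_le_and_ne, eq_comm]
  rw [h, ← Finset.sum_add_distrib]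
  refine Finset.sum_congr rfl fun p _ => ?_
  split_ifs <;> ring

/-- The coefficients of the quadratic form at `x` with respect to the entries on and above the
diagonal. -/
def quadCoeff {d : ℕ} (x : EuclideanSpace ℝ (Fin d)) (p : UpperIndex d) : ℝ :=
  (if p.1.1 = p.1.2 then 1 else 2) * (x p.1.1 * x p.1.2)

theorem quadForm_eq_sum {d : ℕ} {A : Matrix (Fin d) (Fin d) ℝ} (hA : A.IsSymm)
    (x : EuclideanSpace ℝ (Fin d)) :
    quadForm A x = ∑ p : UpperIndex d, quadCoeff x p * A p.1.1 p.1.2 := by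
  rw [quadForm, sum_sum_eq_sum_upperIndex fun i j => by rw [hA.apply, mul_comm (x i)]]
  refine Finset.sum_congr rfl fun p _ => ?_
  rw [quadCoeff]; ring

theorem sum_quadCoeff_sq {d : ℕ} (x : EuclideanSpace ℝ (Fin d)) :
    ∑ p, quadCoeff x p ^ 2 = 2 * ‖x‖ ^ 4 - ∑ i, x i ^ 4 := by
  -- The summand is chosen so that folding gives `4 xᵢ² xⱼ²` off the diagonal and `xᵢ⁴` on it, the
  -- squares of the coefficients.
  have h := sum_sum_eq_sum_upperIndex
    (f := fun i j => 2 * (x i ^ 2 * x j ^ 2) - if i = j then x i ^ 4 else 0) fun i j => by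
      by_cases h : i = j
      · subst h; rfl
      · simp [h, Ne.symm h]; ring
  have h4 : ‖x‖ ^ 4 = (∑ i, x i ^ 2) * ∑ i, x i ^ 2 := by
    rw [← EuclideanSpace.real_norm_sq_eq]; ring
  rw [h4, Finset.sum_mul_sum, Finset.mul_sum]
  simp_rw [Finset.mul_sum]
  simp only [Finset.sum_sub_distrib, Finset.sum_ite_eq, Finset.mem_univ, if_true] at h
  rw [h]
  refine Finset.sum_congr rfl fun p _ => ?_
  rw [quadCoeff]
  by_cases hp : p.1.1 = p.1.2
  · simp [hp]; ring
  · simp [hp]; ring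

/-- Cauchy–Schwarz gives `∑ xᵢ⁴ ≥ ‖x‖⁴ / d`. The gain `1/d` is what brings the exponent of `η` up to
`1` in dimensions one and two. -/
theorem sum_quadCoeff_sq_le {d : ℕ} (hd : 1 ≤ d) (x : EuclideanSpace ℝ (Fin d)) :
    ∑ p, quadCoeff x p ^ 2 ≤ (2 - 1 / d) * ‖x‖ ^ 4 := by
  have hd' : (0 : ℝ) < d := by exact_mod_cast hd
  have h := sq_sum_le_card_mul_sum_sq (s := Finset.univ) (f := fun i => x i ^ 2)
  rw [← EuclideanSpace.real_norm_sq_eq, Finset.card_univ, Fintype.card_fin] at h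
  simp_rw [← pow_mul] at h
  rw [sum_quadCoeff_sq, sub_mul, div_mul_eq_mul_div, one_mul]
  have := (div_le_iff₀' hd').2 h
  norm_num at this
  linarith

theorem IsSymGaussian.map_quadForm {Ω : Type*} [MeasurableSpace Ω] {P : Measure Ω} {d : ℕ}
    {G : Ω → Matrix (Fin d) (Fin d) ℝ} {σ : ℝ} (hG : IsSymGaussian G σ P)
    (x : EuclideanSpace ℝ (Fin d)) :
    P.map (fun ω => quadForm (G ω) x) =
      gaussianReal 0 ((∑ p, quadCoeff x p ^ 2).toNNReal * (σ ^ 2).toNNReal) := by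
  simp_rw [fun ω => quadForm_eq_sum (hG.symm ω) x]
  rw [map_sum_mul_eq_gaussianReal (fun p : UpperIndex d => hG.measurable_apply p.1.1 p.1.2)
    hG.indep (m := fun _ => 0) fun p => hG.law _ _ p.2]
  simp

theorem IsSymGaussian.measure_le_abs_quadForm_le {Ω : Type*} [MeasurableSpace Ω] {P : Measure Ω}
    [IsProbabilityMeasure P] {d : ℕ} {G : Ω → Matrix (Fin d) (Fin d) ℝ} {σ : ℝ}
    (hG : IsSymGaussian G σ P) (hσ : 0 < σ) (hd : 1 ≤ d) {x : EuclideanSpace ℝ (Fin d)} {r t : ℝ}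
    (hx : ‖x‖ ≤ r) (ht : 0 < t) :
    P.real {ω | t ≤ |quadForm (G ω) x|} ≤
      2 * Real.exp (-(t ^ 2 / (2 * (((2 - 1 / d) * r ^ 4) * σ ^ 2)))) := by
  have hd' : (1 : ℝ) ≤ d := by exact_mod_cast hd
  have hd2 : (0 : ℝ) < 2 - 1 / d := by
    have : 1 / (d : ℝ) ≤ 1 := (div_le_one₀ (by positivity)).2 hd'
    linarith
  have hm : Measurable fun ω => quadForm (G ω) x := by
    have := hG.measurable_apply
    unfold quadForm
    fun_prop
  have hc0 : 0 ≤ ∑ p, quadCoeff x p ^ 2 := Finset.sum_nonneg fun _ _ => sq_nonneg _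
  have h := measure_le_abs_le_of_map_eq_gaussianReal hm (hG.map_quadForm x) ht.le
  rw [NNReal.coe_mul, Real.coe_toNNReal _ hc0, Real.coe_toNNReal _ (sq_nonneg σ)] at h
  have hle : ∑ p, quadCoeff x p ^ 2 ≤ (2 - 1 / d) * r ^ 4 :=
    (sum_quadCoeff_sq_le hd x).trans (by gcongr)
  -- At zero variance the tail bound divides by zero and becomes the useless `2 * exp 0`; there the
  -- form is almost surely `0`.
  rcases hc0.eq_or_lt with hc | hc
  · have h0 := hG.map_quadForm x
    rw [← hc, Real.toNNReal_zero, zero_mul, gaussianReal_zero_var] at h0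
    have : P {ω | t ≤ |quadForm (G ω) x|} = 0 := by
      have h1 : P.map (fun ω => quadForm (G ω) x) {y | t ≤ |y|} = 0 := by
        rw [h0, Measure.dirac_apply' _ (measurableSet_le measurable_const (by fun_prop))]
        simp [ht]
      rwa [Measure.map_apply hm (measurableSet_le measurable_const (by fun_prop))] at h1
    rw [measureReal_def, this]
    simp only [ENNReal.toReal_zero]
    positivity
  · refine h.trans ?_
    rw [neg_div]
    gcongr

theorem IsSymGaussian.exists_abs_quadForm_eq_opNorm {Ω : Type*} [MeasurableSpace Ω]
    {P : Measure Ω} {d : ℕ} {G : Ω → Matrix (Fin d) (Fin d) ℝ} {σ : ℝ}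
    (hG : IsSymGaussian G σ P) (hd : 1 ≤ d) (ω : Ω) :
    ∃ u : EuclideanSpace ℝ (Fin d), ‖u‖ = 1 ∧ |quadForm (G ω) u| = opNorm (G ω) := by
  have : Nonempty (Fin d) := ⟨⟨0, hd⟩⟩
  have hsymm : ((Matrix.toEuclideanCLM (n := Fin d) (𝕜 := ℝ) (G ω) :
      EuclideanSpace ℝ (Fin d) →L[ℝ] EuclideanSpace ℝ (Fin d)) :
      EuclideanSpace ℝ (Fin d) →ₗ[ℝ] EuclideanSpace ℝ (Fin d)).IsSymmetric := by
    refine (ContinuousLinearMap.isSelfAdjoint_iff_isSymmetric).1 ?_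
    refine IsSelfAdjoint.map (?_ : IsSelfAdjoint (G ω)) _
    rw [IsSelfAdjoint, Matrix.star_eq_conjTranspose, Matrix.conjTranspose_eq_transpose_of_trivial]
    exact hG.symm ω
  obtain ⟨u, hu, h⟩ := ContinuousLinearMap.IsSymmetric.exists_abs_inner_eq_norm hsymm
  exact ⟨u, hu, by rw [← inner_toEuclideanCLM]; exact h⟩

theorem IsSymGaussian.measure_lt_opNorm_le {Ω : Type*} [MeasurableSpace Ω] {P : Measure Ω}
    [IsProbabilityMeasure P] {d : ℕ} {G : Ω → Matrix (Fin d) (Fin d) ℝ} {σ : ℝ}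
    (hG : IsSymGaussian G σ P) (hσ : 0 < σ) (hd : 1 ≤ d) {s : ℝ} (hs : 0 < s) :
    P.real {ω | s < opNorm (G ω)} ≤
      2 * Real.exp (-(9 / 10 * s ^ 2 / (2 * ((2 - 1 / d) * σ ^ 2)))) * 101 ^ d := by
  have hd' : (1 : ℝ) ≤ d := by exact_mod_cast hd
  have hd2 : (0 : ℝ) < 2 - 1 / d := by
    have : 1 / (d : ℝ) ≤ 1 := (div_le_one₀ (by positivity)).2 hd'
    linarith
  -- The loss factor for `ε = 1/100`. The points `x` then lie in the ball of radius `1 + ε`, and `(1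
  -- + ε) / ε = 101`.
  set c : ℝ := 1 - 2 * (1 / 100) - (1 / 100) ^ 2 with hc
  have hc0 : 0 < c := by norm_num [hc]
  set W : Set (Ω × EuclideanSpace ℝ (Fin d)) := {q | c * s ≤ |quadForm (G q.1) q.2|}
  have hW : MeasurableSet W := by
    have := hG.measurable_apply
    refine measurableSet_le measurable_const ?_
    unfold quadForm
    fun_prop
  have h := measure_le_of_forall_exists_ball_subset (P := P) hW (B := {ω | s < opNorm (G ω)})
    (ε := 1 / 100) (r := 1 + 1 / 100) (by norm_num) (by norm_num)
    (δ := ENNReal.ofReal (2 * Real.exp (-((c * s) ^ 2 /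
      (2 * (((2 - 1 / d) * (1 + 1 / 100) ^ 4) * σ ^ 2)))))) (fun x hx => ?_) fun ω hω => ?_
  · rw [← ENNReal.ofReal_mul (by positivity)] at h
    have h' := ENNReal.toReal_le_of_le_ofReal (by positivity) h
    rw [finrank_euclideanSpace_fin] at h'
    refine h'.trans ?_
    norm_num only
    gcongr 2 * Real.exp (-?_) * _
    -- The factor `9/10` comes from `c² / (1 + 1/100)⁴ ≈ 0.92`.
    rw [div_le_div_iff₀ (by positivity) (by positivity)]
    have : 0 < (2 - 1 / (d : ℝ)) * σ ^ 2 * s ^ 2 := by positivity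
    nlinarith
  · rw [← ofReal_measureReal]
    exact ENNReal.ofReal_le_ofReal (hG.measure_le_abs_quadForm_le hσ hd
      (mem_ball_zero_iff.1 hx).le (by positivity))
  · obtain ⟨u, hu, hq⟩ := hG.exists_abs_quadForm_eq_opNorm hd ω
    refine ⟨u, fun x hx => ?_⟩
    have hxu : ‖x - u‖ < 1 / 100 := by rwa [← dist_eq_norm]
    refine ⟨?_, ?_⟩
    · have := norm_add_le u (x - u)
      rw [add_sub_cancel] at this
      rw [mem_ball_zero_iff]
      linarith
    · have hb := ContinuousLinearMap.mul_norm_le_abs_inner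
        (Matrix.toEuclideanCLM (n := Fin d) (𝕜 := ℝ) (G ω)) hu
        (by rw [inner_toEuclideanCLM]; exact hq) hxu.le
      rw [inner_toEuclideanCLM] at hb
      refine le_trans ?_ hb
      exact mul_le_mul_of_nonneg_left hω.le hc0.le

/-- The unit vectors are `±1`, giving the same quadratic form, so no volume argument is needed and
the factor `9/10` is avoided. -/
theorem IsSymGaussian.measure_lt_opNorm_le_of_one {Ω : Type*} [MeasurableSpace Ω] {P : Measure Ω}
    [IsProbabilityMeasure P] {G : Ω → Matrix (Fin 1) (Fin 1) ℝ} {σ : ℝ}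
    (hG : IsSymGaussian G σ P) (hσ : 0 < σ) {s : ℝ} (hs : 0 < s) :
    P.real {ω | s < opNorm (G ω)} ≤ 2 * Real.exp (-(s ^ 2 / (2 * σ ^ 2))) := by
  have h := hG.measure_le_abs_quadForm_le hσ le_rfl (x := WithLp.toLp 2 fun _ => 1) (r := 1)
    (t := s) (by simp [EuclideanSpace.norm_eq]) hs
  norm_num at h
  refine le_trans (measureReal_mono fun ω hω => ?_) h
  obtain ⟨u, hu, hq⟩ := hG.exists_abs_quadForm_eq_opNorm le_rfl ω
  have hu2 : u 0 * u 0 = 1 := by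
    have := EuclideanSpace.real_norm_sq_eq u
    rw [hu] at this
    simp at this
    nlinarith
  have hlt : s < opNorm (G ω) := hω
  rw [← hq] at hlt
  simp only [quadForm, Finset.univ_unique, Fin.default_eq_zero, Finset.sum_singleton, hu2] at hlt
  simpa [quadForm] using hlt.le

/-- Once `log (2d) ≥ 3k` the exponent is nonpositive, as `3 * 9/20 > 1`. Otherwise `d` is below `exp
(3k)`. -/
theorem exp_mul_sub_le {k : ℝ} (hk : 0 < k) (d : ℕ) (hd : 1 ≤ d) :
    Real.exp (d * (k - 9 / 20 * Real.log (2 * d))) ≤ Real.exp (Real.exp (3 * k) * k) := by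
  have hd' : (1 : ℝ) ≤ d := by exact_mod_cast hd
  have hlog : 0 ≤ Real.log (2 * d) := Real.log_nonneg (by linarith)
  rw [Real.exp_le_exp]
  rcases le_or_gt (3 * k) (Real.log (2 * d)) with h | h
  · refine le_trans (mul_nonpos_of_nonneg_of_nonpos (by positivity) (by linarith)) (by positivity)
  · have h2 : (2 * d : ℝ) < Real.exp (3 * k) := (Real.log_lt_iff_lt_exp (by positivity)).1 h
    calc (d : ℝ) * (k - 9 / 20 * Real.log (2 * d)) ≤ d * k := by gcongr; linarith
      _ ≤ Real.exp (3 * k) * k := by gcongr; linarith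

/-- The constant in the bound for the operator norm of the noise. -/
noncomputable def opNormConst : ℝ := 2 * Real.exp (Real.exp (3 * Real.log 101) * Real.log 101)

theorem IsSymGaussian.measure_lt_opNorm_le_const_mul {Ω : Type*} [MeasurableSpace Ω]
    {P : Measure Ω} [IsProbabilityMeasure P] {d : ℕ} {G : Ω → Matrix (Fin d) (Fin d) ℝ} {σ : ℝ}
    (hG : IsSymGaussian G σ P) (hσ : 0 < σ) (hd : 1 ≤ d) {η : ℝ} (h0 : 0 < η) (h1 : η < 1) :
    P.real {ω | σ * √(2 * d * Real.log (2 * d / η)) < opNorm (G ω)} ≤ opNormConst * η := by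
  have hd' : (1 : ℝ) ≤ d := by exact_mod_cast hd
  have hL := Real.log_pos (one_lt_two_mul_div hd h0 h1)
  have hs : 0 < σ * √(2 * d * Real.log (2 * d / η)) := by positivity
  have hs2 : (σ * √(2 * d * Real.log (2 * d / η))) ^ 2 =
      σ ^ 2 * (2 * d * Real.log (2 * d / η)) := by
    rw [mul_pow, Real.sq_sqrt (by positivity)]
  have hk : 0 < Real.log 101 := Real.log_pos (by norm_num)
  rcases hd.eq_or_lt with rfl | hd2
  · refine (hG.measure_lt_opNorm_le_of_one hσ hs).trans ?_
    rw [hs2, show σ ^ 2 * (2 * ((1 : ℕ) : ℝ) * Real.log (2 * (1 : ℕ) / η)) / (2 * σ ^ 2) =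
      Real.log (2 / η) by push_cast; field_simp, Real.exp_neg, Real.exp_log (by positivity)]
    have : 1 ≤ Real.exp (Real.exp (3 * Real.log 101) * Real.log 101) :=
      Real.one_le_exp (by positivity)
    have h2 : 2 * (2 / η)⁻¹ = η := by field_simp
    rw [h2, opNormConst]
    nlinarith
  · have hd2' : (2 : ℝ) ≤ d := by exact_mod_cast hd2
    refine (hG.measure_lt_opNorm_le hσ hd hs).trans ?_
    have h2d : (0 : ℝ) < 2 * d - 1 := by linarith
    -- The exponent splits into two uses: `a ≥ 1` yields the factor `η`, and `a ≥ 9d/20` yields the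
    -- decay in `d` that beats `101 ^ d`. At `d = 1` one has `a = 9/10`, hence the separate case.
    set a : ℝ := 9 / 10 * (d ^ 2 / (2 * d - 1)) with ha
    have hexp : 9 / 10 * (σ * √(2 * d * Real.log (2 * d / η))) ^ 2 /
        (2 * ((2 - 1 / d) * σ ^ 2)) = a * Real.log (2 * d / η) := by
      rw [hs2, ha, show (2 : ℝ) - 1 / d = (2 * d - 1) / d by field_simp]
      field_simp
    have ha1 : 1 ≤ a := by
      rw [ha, ← mul_div_assoc, le_div_iff₀ h2d]
      nlinarith
    have ha2 : 9 / 20 * d ≤ a := by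
      rw [ha, ← mul_div_assoc, le_div_iff₀ h2d]
      nlinarith
    have hl2 : 0 ≤ Real.log (2 * d) := Real.log_nonneg (by linarith)
    have hlη : Real.log η ≤ 0 := Real.log_nonpos h0.le h1.le
    have hpow : (101 : ℝ) ^ d = Real.exp (d * Real.log 101) := by
      rw [Real.exp_nat_mul, Real.exp_log (by norm_num)]
    rw [hexp, hpow, mul_assoc, ← Real.exp_add, Real.log_div (by positivity) h0.ne']
    calc 2 * Real.exp (-(a * (Real.log (2 * d) - Real.log η)) + d * Real.log 101)
        ≤ 2 * Real.exp (d * (Real.log 101 - 9 / 20 * Real.log (2 * d)) + Real.log η) := by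
          gcongr 2 * Real.exp ?_
          nlinarith [mul_le_mul_of_nonneg_right ha2 hl2, mul_le_mul_of_nonpos_right ha1 hlη]
      _ = 2 * Real.exp (d * (Real.log 101 - 9 / 20 * Real.log (2 * d))) * η := by
          rw [Real.exp_add, Real.exp_log h0, mul_assoc]
      _ ≤ opNormConst * η := by
          unfold opNormConst
          gcongr 2 * ?_ * η
          exact exp_mul_sub_le hk d hd

end PMT

theorem theorem3p3 :
    ∃ C : ℝ, 0 < C ∧
      ∀ (d n m : ℕ), 1 ≤ d → 1 ≤ n → 1 ≤ m →
      ∀ (η μ : ℝ), 0 < η → η < 1 → 0 < μ →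
      ∀ (Ω : Type*) [MeasurableSpace Ω] (P : Measure Ω) [IsProbabilityMeasure P]
        (S : Matrix (Fin d) (Fin d) ℝ)
        (ξ : Fin n → Ω → EuclideanSpace ℝ (Fin d))
        (υ : Fin m → Ω → EuclideanSpace ℝ (Fin d))
        (G : Ω → Matrix (Fin d) (Fin d) ℝ),
        PMT.IsIIDSubG ξ S P →
        PMT.IsIIDSubG υ S P →
        PMT.IsSymGaussian G (PMT.noiseLevel d n η μ) P →
        (∀ ω, (PMT.secondMoment (fun i => υ i ω)).PosDef →
          PMT.IsGDP μ (fun x : Fin n → EuclideanSpace ℝ (Fin d) =>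
            PMT.dpSecondMoment η (PMT.secondMoment (fun i => υ i ω)) G P x)) ∧
        1 - C * η ≤ P.real {ω | PMT.opNorm (G ω) ≤
          2 * √2 * (√((d : ℝ) ^ 3 * Real.log (2 * d / η)) * (1 + Real.log (2 * n / η))
            / (μ * n))} := by
  refine ⟨PMT.opNormConst, by unfold PMT.opNormConst; positivity, ?_⟩
  intro d n m hd hn _ η μ h0 h1 hμ Ω _ P _ S ξ υ G _ _ hG
  refine ⟨fun ω _ => PMT.isGDP_dpSecondMoment hd hn h0 h1 hμ _ hG, ?_⟩
  have h := hG.measure_lt_opNorm_le_const_mul (PMT.noiseLevel_pos hd hn h0 h1 hμ) hd h0 h1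
  have hR : 2 * √2 * (√((d : ℝ) ^ 3 * Real.log (2 * d / η)) * (1 + Real.log (2 * n / η))
      / (μ * n)) = PMT.noiseLevel d n η μ * √(2 * d * Real.log (2 * d / η)) := by
    rw [show (d : ℝ) ^ 3 * Real.log (2 * d / η) = d ^ 2 * (d * Real.log (2 * d / η)) by ring,
      Real.sqrt_mul (by positivity), Real.sqrt_sq (by positivity), mul_assoc 2 (d : ℝ),
      Real.sqrt_mul zero_le_two, PMT.noiseLevel]
    ring
  rw [hR]
  have hu := measureReal_union_le (μ := P)
    {ω | PMT.opNorm (G ω) ≤ PMT.noiseLevel d n η μ * √(2 * d * Real.log (2 * d / η))}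
    {ω | PMT.noiseLevel d n η μ * √(2 * d * Real.log (2 * d / η)) < PMT.opNorm (G ω)}
  have hcover : {ω | PMT.opNorm (G ω) ≤ PMT.noiseLevel d n η μ *
      √(2 * d * Real.log (2 * d / η))} ∪
      {ω | PMT.noiseLevel d n η μ * √(2 * d * Real.log (2 * d / η)) < PMT.opNorm (G ω)} = Set.univ := by
    ext ω; simp [le_or_gt]
  rw [hcover, probReal_univ] at hu
  linarith
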